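/- Let $N\ge 2$ and $q\ge 2$ be integers and consider $N$ sites, each of local dimension $q$, with state space $(\mathbb{C}^q)^{\otimes N}$. For a set $S$ of sites let $G_S=\mathbb{E}\big[V\otimes V\otimes\overline{V}\otimes\overline{V}\big]$, where $V=U\otimes 1$ and $U$ is a Haar-random unitary on the sites in $S$; this is the vectorization of the second-moment operator $X\mapsto\mathbb{E}\big[(V\otimes V)X(V\otimes V)^\dagger\big]$. Let $G_1,G_2,G_3$ be the operators $G_S$ for, respectively, $S$ = all sites except the first, $S$ = the first and second sites, $S$ = all sites except the second. By the largest non-unit eigenvalue of an operator we mean an eigenvalue $\lambda\ne 1$ that is real and satisfies $|z|\le\lambda$ for every complex eigenvalue $z\neq 1$. (i) The largest non-unit eigenvalue of $G_1G_2G_3G_2G_1$ exists and equals $$\lambda=\left(\frac{q^{2N}-q^4}{q^{2N}-q^2}\cdot\frac{1}{q^2+1}\right)^2 .$$ (ii) If $N\ge 3$, the largest non-unit eigenvalue of $G_1G_3G_1$ exists and equals $$\lambda'=\left(\frac{q^2-1}{q^N-q^{2-N}}\right)^2 .$$ (iii) For qubits ($q=2$), $\lambda\to\frac1{25}$ and $\lambda'\to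 0$ as $N\to\infty$. -/

import Mathlib

open MeasureTheory Filter
open scoped Kronecker Matrix

noncomputable section

namespace RandomCircuit

/-- The Borel sigma-algebra on the unitary group `U(n)`. -/
instance unitaryMeasurableSpace (n : Type) [Fintype n] [DecidableEq n] :
    MeasurableSpace (Matrix.unitaryGroup n ℂ) := borel _

instance unitaryBorelSpace (n : Type) [Fintype n] [DecidableEq n] :
    BorelSpace (Matrix.unitaryGroup n ℂ) := ⟨rfl⟩

/-- The unitary group `U(n)` is compact. -/
instance unitaryCompactSpace (n : Type) [Fintype n] [DecidableEq n] :
    CompactSpace (Matrix.unitaryGroup n ℂ) := by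
  have hK : IsCompact (Set.pi Set.univ fun _ : n =>
      Set.pi Set.univ fun _ : n => Metric.closedBall (0 : ℂ) 1) :=
    isCompact_univ_pi fun _ => isCompact_univ_pi fun _ => isCompact_closedBall _ _
  have hC : IsClosed {U : Matrix n n ℂ | U * star U = 1} :=
    isClosed_eq (by fun_prop) continuous_const
  have hE : (Matrix.unitaryGroup n ℂ : Set (Matrix n n ℂ)) = {U | U * star U = 1} :=
    Set.ext fun U => Matrix.mem_unitaryGroup_iff
  refine isCompact_iff_compactSpace.mp (hK.of_isClosed_subset (hE ▸ hC) ?_)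
  · intro U hU i _ j _
    simpa using entry_norm_bound_of_unitary hU i j

/-- The Haar probability measure on the unitary group `U(n)`. -/
def haarUnitary (n : Type) [Fintype n] [DecidableEq n] :
    Measure (Matrix.unitaryGroup n ℂ) :=
  Measure.haarMeasure ⊤

/-- The computational basis of a collection `ι` of sites, each of local dimension `q`;
`(ℂ^q)^{⊗ ι}` is the space of complex functions on it. -/
abbrev Config (ι : Type) (q : ℕ) : Type := ι → Fin q

/-- The gate `U ⊗ 1`: the matrix `U` acting on the sites in `S`, the identity on all the others. -/
def gate {N q : ℕ} (S : Finset (Fin N)) (U : Matrix (Config S q) (Config S q) ℂ) :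
    Matrix (Config (Fin N) q) (Config (Fin N) q) ℂ :=
  Matrix.of fun x y =>
    if ∀ i, i ∉ S → x i = y i then U (fun i => x i) (fun i => y i) else 0

/-- Indices of a vectorized operator on two copies of `N` sites of local dimension `q`:
the two row indices and the two column indices of the operator. -/
abbrev VecIndex (N q : ℕ) : Type :=
  (Config (Fin N) q × Config (Fin N) q) × (Config (Fin N) q × Config (Fin N) q)

/-- The matrix `V ⊗ V ⊗ V̄ ⊗ V̄`: the vectorization of `X ↦ (V ⊗ V) X (V ⊗ V)†`. -/
def vecConj {N q : ℕ} (V : Matrix (Config (Fin N) q) (Config (Fin N) q) ℂ) :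
    Matrix (VecIndex N q) (VecIndex N q) ℂ :=
  (V ⊗ₖ V) ⊗ₖ (V.map star ⊗ₖ V.map star)

/-- The vectorized second moment operator `E[V ⊗ V ⊗ V̄ ⊗ V̄]`, where `V` is a Haar-random
unitary gate on the sites in `S`. -/
def secondMoment (N q : ℕ) (S : Finset (Fin N)) : Matrix (VecIndex N q) (VecIndex N q) ℂ :=
  Matrix.of fun a b => ∫ U, vecConj (gate S U.1) a b ∂(haarUnitary (Config S q))

/-- `G₁`: the gate acts on every site except the first. Sites are numbered from `0` here. -/
def G₁ (N q : ℕ) : Matrix (VecIndex N q) (VecIndex N q) ℂ :=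
  secondMoment N q {i | i.val ≠ 0}

/-- `G₂`: the gate acts on the first and second sites. -/
def G₂ (N q : ℕ) : Matrix (VecIndex N q) (VecIndex N q) ℂ :=
  secondMoment N q {i | i.val = 0 ∨ i.val = 1}

/-- `G₃`: the gate acts on every site except the second. -/
def G₃ (N q : ℕ) : Matrix (VecIndex N q) (VecIndex N q) ℂ :=
  secondMoment N q {i | i.val ≠ 1}

/-- The second moment operator of one period of the five-gate architecture `C`. -/
def circuitC (N q : ℕ) : Matrix (VecIndex N q) (VecIndex N q) ℂ :=
  G₁ N q * G₂ N q * G₃ N q * G₂ N q * G₁ N q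

/-- The second moment operator of one period of `C'`, where the second and fourth gates are
deleted. -/
def circuitC' (N q : ℕ) : Matrix (VecIndex N q) (VecIndex N q) ℂ :=
  G₁ N q * G₃ N q * G₁ N q

/-- The eigenvalues of `A` other than `1`. -/
def nonUnitEigenvalues {m : Type} [Fintype m] [DecidableEq m] (A : Matrix m m ℂ) : Set ℂ :=
  {z | Module.End.HasEigenvalue (Matrix.toLin' A) z ∧ z ≠ 1}

/-- `lam` is the largest non-unit eigenvalue of `A`: it is an eigenvalue other than `1`, and it
bounds the modulus (hence the real part) of every complex eigenvalue other than `1`. -/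
def IsLargestNonUnitEigenvalue {m : Type} [Fintype m] [DecidableEq m] (A : Matrix m m ℂ)
    (lam : ℝ) : Prop :=
  (lam : ℂ) ∈ nonUnitEigenvalues A ∧ ∀ z ∈ nonUnitEigenvalues A, ‖z‖ ≤ lam

end RandomCircuit

end

/-! Averaging over a gate on `S` projects each vector, on the sites of `S`, onto the span of two
vectors: the vectorized identity and swap. This holds because the commutant of all `W ⊗ W` is
spanned by the identity and the swap (`apply_of_commute_unitary`). Left invariance of Haar measure
then gives the Weingarten formula `secondMoment_apply`.

On tensor products of identities and swaps, one gate makes its sites all equal, with coefficients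
`kappa` (`secondMoment_mulVec_permVec`). Both circuits end with two gates that together cover all
sites, so their images lie in `firstSpan`: one label on the first site, one on the rest. The two
globally constant vectors are fixed. Subtracting from the other two their projection onto these
gives `reducedFirst`. The gates permute the three families of reduced vectors up to a scalar, so
each circuit multiplies `reducedFirst` by one number, a square of `kappa`s. On `firstSpan` the
circuit is thus annihilated by `(z - 1)(z - λ)`, and any eigenvector with nonzero eigenvalue lies
there, so the only possible eigenvalues are `0`, `1` and `λ`. -/

noncomputable section

namespace RandomCircuit

/-! ### The commutant of `W ⊗ W`. -/

section Commutant

variable {n : Type} [DecidableEq n]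

/-- The operator `A ⊗ 1 + 1 ⊗ A`. -/
def kroneckerSum (A : Matrix n n ℂ) : Matrix (n × n) (n × n) ℂ :=
  A ⊗ₖ (1 : Matrix n n ℂ) + (1 : Matrix n n ℂ) ⊗ₖ A

theorem kroneckerSum_add (A B : Matrix n n ℂ) :
    kroneckerSum (A + B) = kroneckerSum A + kroneckerSum B := by
  simp only [kroneckerSum, Matrix.add_kronecker, Matrix.kronecker_add]; abel

theorem kroneckerSum_smul (c : ℂ) (A : Matrix n n ℂ) :
    kroneckerSum (c • A) = c • kroneckerSum A := by
  simp only [kroneckerSum, Matrix.smul_kronecker, Matrix.kronecker_smul, smul_add]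

/-- For a projection `P`, the unitaries `1 + c P` tensored with themselves carry `kroneckerSum P` in
the coefficient of `c`, which gives access to the Lie algebra action without differentiation. -/
theorem kronecker_one_add_smul (c : ℂ) (P : Matrix n n ℂ) :
    (1 + c • P) ⊗ₖ (1 + c • P) = 1 + c • kroneckerSum P + (c * c) • (P ⊗ₖ P) := by
  simp only [kroneckerSum, Matrix.add_kronecker, Matrix.kronecker_add, Matrix.smul_kronecker,
    Matrix.kronecker_smul, smul_add, Matrix.one_kronecker_one, smul_smul]
  abel

variable [Fintype n]

theorem one_add_smul_mem_unitaryGroup {P : Matrix n n ℂ} (hP : P * P = P) (hs : star P = P)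
    -- The condition says `|1 + c| = 1`.
    {c : ℂ} (hc : c + star c + c * star c = 0) :
    1 + c • P ∈ Matrix.unitaryGroup n ℂ := by
  rw [Matrix.mem_unitaryGroup_iff]
  have : (1 + c • P) * star (1 + c • P) = 1 + (c + star c + c * star c) • P := by
    simp only [star_add, star_one, star_smul, hs, add_mul, mul_add, one_mul, mul_one,
      smul_mul_smul_comm, hP, add_smul]
    abel
  rw [this, hc, zero_smul, add_zero]

theorem commute_kroneckerSum_projection {X : Matrix (n × n) (n × n) ℂ}
    (hX : ∀ W ∈ Matrix.unitaryGroup n ℂ, Commute (W ⊗ₖ W) X)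
    {P : Matrix n n ℂ} (hP : P * P = P) (hs : star P = P) :
    Commute (kroneckerSum P) X := by
  have h1 := hX _ (one_add_smul_mem_unitaryGroup hP hs (c := -2) (by norm_num))
  have h2 := hX _ (one_add_smul_mem_unitaryGroup hP hs (c := Complex.I - 1) (by
    apply Complex.ext <;> simp))
  rw [kronecker_one_add_smul] at h1 h2
  have hI : (Complex.I - 1) * (Complex.I - 1) = -2 * Complex.I := by
    linear_combination Complex.I_mul_I
  rw [hI] at h2
  have h1' := h1.sub_left (Commute.one_left X)
  have h2' := h2.sub_left (Commute.one_left X)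
  -- The values `c = -2` and `c = i - 1` have squares `4` and `-2i`; weighting the first relation by
  -- `i/2` cancels `P ⊗ P` and leaves `-kroneckerSum P`.
  have key : kroneckerSum P =
      -((Complex.I / 2) •
        (1 + (-2 : ℂ) • kroneckerSum P + ((-2 : ℂ) * (-2)) • (P ⊗ₖ P) - 1) +
      (1 : ℂ) • (1 + (Complex.I - 1) • kroneckerSum P + (-2 * Complex.I) • (P ⊗ₖ P) - 1)) := by
    module
  rw [key]
  exact ((h1'.smul_left _).add_left (h2'.smul_left _)).neg_left

/-- Matrix units are complex combinations of orthogonal projections, by polarization. -/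
theorem commute_kroneckerSum_single {X : Matrix (n × n) (n × n) ℂ}
    (hX : ∀ W ∈ Matrix.unitaryGroup n ℂ, Commute (W ⊗ₖ W) X) (r s : n) :
    Commute (kroneckerSum (Matrix.single r s 1)) X := by
  have hdiag : ∀ r : n, Commute (kroneckerSum (Matrix.single r r 1)) X := fun r =>
    commute_kroneckerSum_projection hX (by simp) (by simp [Matrix.star_eq_conjTranspose])
  by_cases hrs : r = s
  · exact hrs ▸ hdiag r
  have hoff : ∀ ω : ℂ, ω * star ω = 1 →
      Commute (kroneckerSum (ω • Matrix.single s r 1 + star ω • Matrix.single r s 1)) X := by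
    intro ω hω
    -- `Q = v v*` with `v = e_r + ω e_s` of squared norm `2`, so `Q / 2` is a projection.
    set Q : Matrix n n ℂ := Matrix.single r r 1 + Matrix.single s s 1 +
      (ω • Matrix.single s r 1 + star ω • Matrix.single r s 1) with hQ
    have hQQ : Q * Q = (2 : ℂ) • Q := by
      have hsr : s ≠ r := Ne.symm hrs
      simp only [hQ, add_mul, mul_add, smul_mul_assoc, mul_smul_comm,
        Matrix.single_mul_single_same, Matrix.single_mul_single_of_ne _ _ _ _ hrs,
        Matrix.single_mul_single_of_ne _ _ _ _ hsr, mul_one, smul_zero, add_zero, zero_add]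
      match_scalars <;> first | ring1 | linear_combination hω
    have hQs : star Q = Q := by
      simp only [hQ, Matrix.star_eq_conjTranspose, Matrix.conjTranspose_add,
        Matrix.conjTranspose_smul, Matrix.conjTranspose_single, star_one, star_star]
      abel
    have := commute_kroneckerSum_projection hX (P := (1 / 2 : ℂ) • Q)
      (by rw [smul_mul_smul_comm, hQQ, smul_smul]; norm_num)
      (by rw [star_smul, hQs]; simp)
    rw [kroneckerSum_smul] at this
    have h2 := this.smul_left (2 : ℂ)
    rw [smul_smul] at h2
    norm_num at h2
    rw [hQ, kroneckerSum_add, kroneckerSum_add] at h2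
    simpa using (h2.sub_left ((hdiag r).add_left (hdiag s)))
  have h1 := hoff 1 (by simp)
  have h2 := hoff Complex.I (by simp)
  have h := (h1.smul_left (1 / 2 : ℂ)).add_left (h2.smul_left (Complex.I / 2))
  rw [← kroneckerSum_smul, ← kroneckerSum_smul, ← kroneckerSum_add] at h
  have hE : Matrix.single r s (1 : ℂ) =
      (1 / 2 : ℂ) • ((1 : ℂ) • Matrix.single s r 1 + star (1 : ℂ) • Matrix.single r s 1) +
        (Complex.I / 2) • (Complex.I • Matrix.single s r 1 +
          star Complex.I • Matrix.single r s 1) := by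
    simp only [star_one, Complex.star_def, Complex.conj_I]
    match_scalars
    · linear_combination Complex.I_mul_I / 2
    · linear_combination -Complex.I_mul_I / 2
  rwa [hE]

theorem apply_relation_of_commute {X : Matrix (n × n) (n × n) ℂ} {r s : n}
    (h : Commute (kroneckerSum (Matrix.single r s 1)) X) (i j k l : n) :
    (if i = r then X (s, j) (k, l) else 0) + (if j = r then X (i, s) (k, l) else 0) =
      (if k = s then X (i, j) (r, l) else 0) + (if l = s then X (i, j) (k, r) else 0) := by
  have h := congr_fun (congr_fun h.eq (i, j)) (k, l)
  simp only [Matrix.mul_apply, kroneckerSum, Matrix.add_apply, Matrix.kroneckerMap_apply,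
    Fintype.sum_prod_type, Matrix.single_apply, Matrix.one_apply, add_mul, mul_add,
    Finset.sum_add_distrib, ite_and, mul_ite, ite_mul, mul_one, mul_zero, one_mul, zero_mul] at h
  simpa [eq_comm, Finset.sum_ite_irrel] using h

/-- An operator commuting with every `W ⊗ W` is a combination of the identity and the swap. -/
theorem apply_of_commute_unitary {X : Matrix (n × n) (n × n) ℂ}
    (hX : ∀ W ∈ Matrix.unitaryGroup n ℂ, Commute (W ⊗ₖ W) X) (i j k l : n) :
    (Fintype.card n : ℂ) * ((Fintype.card n : ℂ) ^ 2 - 1) * X (i, j) (k, l) =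
      ((Fintype.card n : ℂ) * (∑ a, ∑ b, X (a, b) (a, b)) - ∑ a, ∑ b, X (a, b) (b, a)) *
        (if i = k ∧ j = l then 1 else 0) +
      ((Fintype.card n : ℂ) * (∑ a, ∑ b, X (a, b) (b, a)) - ∑ a, ∑ b, X (a, b) (a, b)) *
        (if i = l ∧ j = k then 1 else 0) := by
  have R := fun r s => apply_relation_of_commute (commute_kroneckerSum_single hX r s)
  set d : ℂ := (Fintype.card n : ℂ) with hd
  set P : n → n → ℂ := fun j l => ∑ k, X (k, j) (k, l) with hP
  set Q : n → n → ℂ := fun j l => ∑ k, X (j, k) (k, l) with hQ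
  -- Tracing out the first factor cancels one term on each side; what remains says that the partial
  -- trace `P` commutes with every matrix unit, hence is scalar. The same works for the partial
  -- trace `Q` twisted by the swap.
  have hP1 : ∀ j l r s, (if j = r then P s l else 0) = (if l = s then P j r else 0) := by
    intro j l r s
    have := Finset.sum_congr rfl (fun i (_ : i ∈ Finset.univ) => R r s i j i l)
    simpa [Finset.sum_add_distrib, hP, Finset.sum_ite_irrel] using this
  have hQ1 : ∀ i l r s, (if i = r then Q s l else 0) = (if l = s then Q i r else 0) := by
    intro i l r s
    have := Finset.sum_congr rfl (fun k (_ : k ∈ Finset.univ) => R r s i k k l)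
    simp only [Finset.sum_add_distrib, Finset.sum_ite_irrel, Finset.sum_ite_eq',
      Finset.mem_univ, if_true, Finset.sum_const_zero] at this
    rw [add_comm] at this
    exact add_left_cancel this
  have hP2 : ∀ s l, d * P s l = if l = s then ∑ a, ∑ b, X (a, b) (a, b) else 0 := by
    intro s l
    have := Finset.sum_congr rfl (fun j (_ : j ∈ Finset.univ) => hP1 j l j s)
    simp only [if_true, Finset.sum_const, Finset.card_univ, nsmul_eq_mul,
      Finset.sum_ite_irrel, mul_zero] at this
    rw [hd, this, show ∑ x, P x x = ∑ a, ∑ b, X (a, b) (a, b) from Finset.sum_comm]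
  have hQ2 : ∀ s l, d * Q s l = if l = s then ∑ a, ∑ b, X (a, b) (b, a) else 0 := by
    intro s l
    have := Finset.sum_congr rfl (fun j (_ : j ∈ Finset.univ) => hQ1 j l j s)
    simp only [if_true, Finset.sum_const, Finset.card_univ, nsmul_eq_mul,
      Finset.sum_ite_irrel, mul_zero] at this
    rw [hd, this]
  -- Setting `s = k` and summing relates an entry of `X` to its swapped partner. With `k` and `l`
  -- exchanged this is a 2×2 linear system of determinant `d ^ 2 - 1`.
  have hC : ∀ i j r l, d * X (i, j) (r, l) + X (i, j) (l, r) =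
      (if i = r then P j l else 0) + (if j = r then Q i l else 0) := by
    intro i j r l
    have := Finset.sum_congr rfl (fun k (_ : k ∈ Finset.univ) => R r k i j k l)
    simp only [Finset.sum_add_distrib, if_true, Finset.sum_const, Finset.card_univ, nsmul_eq_mul,
      Finset.sum_ite_irrel, mul_zero, Finset.sum_ite_eq, Finset.mem_univ] at this
    rw [hd, ← this]
  have h1 := hC i j k l
  have h2 := hC i j l k
  have e1 := hP2 j l
  have e2 := hQ2 i l
  have e3 := hP2 j k
  have e4 := hQ2 i k
  set T := ∑ a, ∑ b, X (a, b) (a, b)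
  set F := ∑ a, ∑ b, X (a, b) (b, a)
  have f1 : d * (d * X (i, j) (k, l) + X (i, j) (l, k)) =
      T * (if i = k ∧ j = l then 1 else 0) + F * (if i = l ∧ j = k then 1 else 0) := by
    rw [h1, mul_add, mul_ite, mul_ite, mul_zero, e1, e2]
    simp only [ite_and, eq_comm (a := l)]
    split_ifs <;> simp
  have f2 : d * (d * X (i, j) (l, k) + X (i, j) (k, l)) =
      T * (if i = l ∧ j = k then 1 else 0) + F * (if i = k ∧ j = l then 1 else 0) := by
    rw [h2, mul_add, mul_ite, mul_ite, mul_zero, e3, e4]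
    simp only [ite_and, eq_comm (a := k)]
    split_ifs <;> simp
  linear_combination d * f1 - f2

end Commutant

/-! ### Second moments of Haar measure. -/

section Haar

variable {n : Type} [Fintype n] [DecidableEq n]

instance haarUnitary_isProbabilityMeasure : IsProbabilityMeasure (haarUnitary n) :=
  ⟨Measure.haarMeasure_self⟩

instance haarUnitary_isMulLeftInvariant : (haarUnitary n).IsMulLeftInvariant :=
  inferInstanceAs (Measure.haarMeasure ⊤).IsMulLeftInvariant

theorem integrable_haarUnitary {f : Matrix.unitaryGroup n ℂ → ℂ} (hf : Continuous f) :
    Integrable f (haarUnitary n) :=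
  hf.integrable_of_hasCompactSupport (HasCompactSupport.of_compactSpace f)

/-- The second moment map `X ↦ E[(U ⊗ U) X (U ⊗ U)†]`. -/
def twirl (E : Matrix (n × n) (n × n) ℂ) : Matrix (n × n) (n × n) ℂ :=
  Matrix.of fun a b => ∫ U, ((U.1 ⊗ₖ U.1) * E * (U.1 ⊗ₖ U.1)ᴴ) a b ∂(haarUnitary n)

theorem continuous_conj_apply (E : Matrix (n × n) (n × n) ℂ) (a b : n × n) :
    Continuous fun U : Matrix.unitaryGroup n ℂ =>
      ((U.1 ⊗ₖ U.1) * E * (U.1 ⊗ₖ U.1)ᴴ) a b := by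
  simp only [Matrix.mul_apply, Matrix.conjTranspose_apply, Matrix.kroneckerMap_apply]
  have h : ∀ i j : n, Continuous fun U : Matrix.unitaryGroup n ℂ => U.1 i j := fun i j =>
    (continuous_subtype_val).matrix_elem i j
  have h' : ∀ i j : n, Continuous fun U : Matrix.unitaryGroup n ℂ => star (U.1 i j) :=
    fun i j => (h i j).star
  simp only [star_mul']
  exact continuous_finsetSum _ fun x _ => (continuous_finsetSum _ fun j _ =>
    ((h _ _).mul (h _ _)).mul continuous_const).mul ((h' _ _).mul (h' _ _))

theorem twirl_conj {E : Matrix (n × n) (n × n) ℂ} (A B : Matrix (n × n) (n × n) ℂ) (a b : n × n) :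
    (A * twirl E * B) a b =
      ∫ U, (A * ((U.1 ⊗ₖ U.1) * E * (U.1 ⊗ₖ U.1)ᴴ) * B) a b ∂(haarUnitary n) := by
  have hi := fun a b => integrable_haarUnitary (continuous_conj_apply E a b)
  simp only [Matrix.mul_apply (M := A * _), Matrix.mul_apply (M := A)]
  rw [integral_finsetSum _ fun j _ =>
    (integrable_finsetSum _ fun k _ => (hi k j).const_mul (A a k)).mul_const _]
  refine Finset.sum_congr rfl fun j _ => ?_
  rw [integral_mul_const, integral_finsetSum _ fun k _ => (hi k j).const_mul (A a k)]
  simp only [integral_const_mul]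
  rfl

/-- Left invariance absorbs `W` into the integration variable, so conjugation by `W ⊗ W` fixes the
twirl. -/
theorem commute_twirl (E : Matrix (n × n) (n × n) ℂ) (W : Matrix n n ℂ)
    (hW : W ∈ Matrix.unitaryGroup n ℂ) : Commute (W ⊗ₖ W) (twirl E) := by
  have hWW : W * Wᴴ = 1 := Matrix.mem_unitaryGroup_iff.mp hW
  have hWW' : Wᴴ * W = 1 := Matrix.mem_unitaryGroup_iff'.mp hW
  have h : (W ⊗ₖ W) * twirl E * (W ⊗ₖ W)ᴴ = twirl E := by
    ext a b
    rw [twirl_conj]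
    have := integral_mul_left_eq_self (μ := haarUnitary n)
      (fun U => ((U.1 ⊗ₖ U.1) * E * (U.1 ⊗ₖ U.1)ᴴ) a b) ⟨W, hW⟩
    rw [twirl, Matrix.of_apply, ← this]
    refine integral_congr_ae (.of_forall fun U => ?_)
    simp only [Submonoid.coe_mul, Matrix.mul_kronecker_mul, Matrix.conjTranspose_mul,
      Matrix.mul_assoc]
  have hu : (W ⊗ₖ W)ᴴ * (W ⊗ₖ W) = 1 := by
    rw [Matrix.conjTranspose_kronecker, ← Matrix.mul_kronecker_mul, hWW', Matrix.one_kronecker_one]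
  calc (W ⊗ₖ W) * twirl E = (W ⊗ₖ W) * twirl E * ((W ⊗ₖ W)ᴴ * (W ⊗ₖ W)) := by rw [hu, mul_one]
    _ = twirl E * (W ⊗ₖ W) := by rw [← Matrix.mul_assoc, h]

theorem sum_mul_star_of_mem_unitaryGroup (U : Matrix.unitaryGroup n ℂ) (i j : n) :
    ∑ a, U.1 a i * star (U.1 a j) = if i = j then 1 else 0 := by
  have h := congr_fun (congr_fun (Matrix.mem_unitaryGroup_iff'.mp U.2) j) i
  rw [Matrix.mul_apply, Matrix.one_apply] at h
  simp only [Matrix.star_apply] at h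
  simp only [eq_comm (a := i), ← h]
  exact Finset.sum_congr rfl fun a _ => mul_comm _ _

theorem conj_single_apply (U : Matrix n n ℂ) (p q r s i j k l : n) :
    ((U ⊗ₖ U) * Matrix.single (p, q) (r, s) (1 : ℂ) * (U ⊗ₖ U)ᴴ) (i, j) (k, l) =
      U i p * U j q * (star (U k r) * star (U l s)) := by
  simp [Matrix.mul_apply, Matrix.single_apply, ite_and]

/-- The second moments of the entries of a Haar-random unitary. -/
theorem integral_unitary_second_moment (p q r s i j k l : n) :
    (Fintype.card n : ℂ) * ((Fintype.card n : ℂ) ^ 2 - 1) *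
      ∫ U, U.1 i p * U.1 j q * (star (U.1 k r) * star (U.1 l s)) ∂(haarUnitary n) =
      ((Fintype.card n : ℂ) * (if p = r ∧ q = s then 1 else 0) -
        (if p = s ∧ q = r then 1 else 0)) * (if i = k ∧ j = l then 1 else 0) +
      ((Fintype.card n : ℂ) * (if p = s ∧ q = r then 1 else 0) -
        (if p = r ∧ q = s then 1 else 0)) * (if i = l ∧ j = k then 1 else 0) := by
  have h := apply_of_commute_unitary (commute_twirl (Matrix.single (p, q) (r, s) (1 : ℂ))) i j k l
  have hi := fun a b => integrable_haarUnitary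
    (continuous_conj_apply (Matrix.single (p, q) (r, s) (1 : ℂ)) a b)
  -- Conjugation by `U ⊗ U` preserves the trace, and the trace against the swap, so both are read
  -- off from the matrix unit.
  have hT : ∑ a, ∑ b, twirl (Matrix.single (p, q) (r, s) (1 : ℂ)) (a, b) (a, b) =
      if p = r ∧ q = s then 1 else 0 := by
    simp only [twirl, Matrix.of_apply]
    simp_rw [← integral_finsetSum _ fun b _ => hi (_, b) (_, b)]
    rw [← integral_finsetSum _ fun a _ => integrable_finsetSum _ fun b _ => hi (a, b) (a, b)]
    have : ∀ U : Matrix.unitaryGroup n ℂ, ∑ a, ∑ b,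
        ((U.1 ⊗ₖ U.1) * Matrix.single (p, q) (r, s) (1 : ℂ) * (U.1 ⊗ₖ U.1)ᴴ) (a, b) (a, b) =
        if p = r ∧ q = s then 1 else 0 := by
      intro U
      simp only [conj_single_apply, mul_mul_mul_comm (U.1 _ p), ← Finset.mul_sum,
        ← Finset.sum_mul, sum_mul_star_of_mem_unitaryGroup]
      split_ifs <;> simp_all
    simp [this]
  have hF : ∑ a, ∑ b, twirl (Matrix.single (p, q) (r, s) (1 : ℂ)) (a, b) (b, a) =
      if p = s ∧ q = r then 1 else 0 := by
    simp only [twirl, Matrix.of_apply]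
    simp_rw [← integral_finsetSum _ fun b _ => hi (_, b) (b, _)]
    rw [← integral_finsetSum _ fun a _ => integrable_finsetSum _ fun b _ => hi (a, b) (b, a)]
    have : ∀ U : Matrix.unitaryGroup n ℂ, ∑ a, ∑ b,
        ((U.1 ⊗ₖ U.1) * Matrix.single (p, q) (r, s) (1 : ℂ) * (U.1 ⊗ₖ U.1)ᴴ) (a, b) (b, a) =
        if p = s ∧ q = r then 1 else 0 := by
      intro U
      simp only [conj_single_apply, mul_comm (star (U.1 _ r)), mul_mul_mul_comm (U.1 _ p),
        ← Finset.mul_sum, ← Finset.sum_mul, sum_mul_star_of_mem_unitaryGroup]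
      split_ifs <;> simp_all
    simp [this]
  rw [hT, hF, twirl, Matrix.of_apply] at h
  simpa only [conj_single_apply] using h

end Haar

/-! ### Second moment operators on product vectors. -/

section Product

variable {N q : ℕ}

/-- The indices of two copies of a vectorized operator on one site. -/
abbrev SiteIndex (q : ℕ) : Type := (Fin q × Fin q) × (Fin q × Fin q)

/-- The indices of `a` at the site `i`. -/
def site (a : VecIndex N q) (i : Fin N) : SiteIndex q :=
  ((a.1.1 i, a.1.2 i), (a.2.1 i, a.2.2 i))

/-- The vectorized identity (`true`) or swap (`false`) on two copies of one site. -/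
def pairing (σ : Bool) (s : SiteIndex q) : ℂ :=
  if σ then (if s.1.1 = s.2.1 ∧ s.1.2 = s.2.2 then 1 else 0)
  else (if s.1.1 = s.2.2 ∧ s.1.2 = s.2.1 then 1 else 0)

/-- The tensor product of vectors on the sites. -/
def productVec (h : Fin N → SiteIndex q → ℂ) (a : VecIndex N q) : ℂ :=
  ∏ i, h i (site a i)

/-- The tensor product of vectorized identities and swaps. -/
def permVec (f : Fin N → Bool) : VecIndex N q → ℂ :=
  productVec fun i => pairing (f i)

/-- The Weingarten function on two copies in dimension `d`. -/
def weingarten (d : ℂ) (σ τ : Bool) : ℂ :=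
  (if σ = τ then d else -1) / (d * (d ^ 2 - 1))

/-- A vectorized operator is a configuration of the site indices. -/
def vecIndexEquiv (N q : ℕ) : VecIndex N q ≃ (Fin N → SiteIndex q) where
  toFun a := site a
  invFun s := ((fun i => (s i).1.1, fun i => (s i).1.2), (fun i => (s i).2.1, fun i => (s i).2.2))
  left_inv _ := rfl
  right_inv _ := rfl

theorem sum_prod_site (h : Fin N → SiteIndex q → ℂ) :
    ∑ a : VecIndex N q, ∏ i, h i (site a i) = ∏ i, ∑ s, h i s := by
  rw [Fintype.prod_sum, ← (vecIndexEquiv N q).sum_comp]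
  rfl

theorem site_injective : Function.Injective (site : VecIndex N q → Fin N → SiteIndex q) :=
  (vecIndexEquiv N q).injective

theorem prod_site_eq (a b : VecIndex N q) :
    ∏ i, (if site a i = site b i then (1 : ℂ) else 0) = if a = b then 1 else 0 := by
  rw [Fintype.prod_boole]
  simp only [← funext_iff, site_injective.eq_iff]

theorem prod_pairing (S : Finset (Fin N)) (σ : Bool) (a : VecIndex N q) :
    ∏ i ∈ S, pairing σ (site a i) =
      if σ then (if (∀ i ∈ S, a.1.1 i = a.2.1 i) ∧ ∀ i ∈ S, a.1.2 i = a.2.2 i then 1 else 0)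
      else (if (∀ i ∈ S, a.1.1 i = a.2.2 i) ∧ ∀ i ∈ S, a.1.2 i = a.2.1 i then 1 else 0) := by
  cases σ
  · change (∏ i ∈ S, if a.1.1 i = a.2.2 i ∧ a.1.2 i = a.2.1 i then (1 : ℂ) else 0) = _
    rw [Finset.prod_boole]
    simp only [forall₂_and, Bool.false_eq_true, if_false]
  · change (∏ i ∈ S, if a.1.1 i = a.2.1 i ∧ a.1.2 i = a.2.2 i then (1 : ℂ) else 0) = _
    rw [Finset.prod_boole]
    simp only [forall₂_and, if_true]

/-- The Weingarten formula on `S` times the identity elsewhere. If the indices differ at a site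
outside `S`, both sides vanish. -/
theorem secondMoment_apply {S : Finset (Fin N)} (hq : 2 ≤ q) (hS : S.Nonempty)
    (a b : VecIndex N q) :
    secondMoment N q S a b = ∑ σ, ∑ τ, weingarten ((q : ℂ) ^ S.card) σ τ *
      ∏ i, if i ∈ S then pairing σ (site a i) * pairing τ (site b i)
        else if site a i = site b i then 1 else 0 := by
  obtain ⟨⟨x₁, x₂⟩, ⟨y₁, y₂⟩⟩ := a
  obtain ⟨⟨u₁, u₂⟩, ⟨w₁, w₂⟩⟩ := b
  by_cases hout : ∀ i, i ∉ S → (x₁ i = u₁ i ∧ x₂ i = u₂ i) ∧ y₁ i = w₁ i ∧ y₂ i = w₂ i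
  · have h1 : ∀ i, i ∉ S → x₁ i = u₁ i := fun i hi => (hout i hi).1.1
    have h2 : ∀ i, i ∉ S → x₂ i = u₂ i := fun i hi => (hout i hi).1.2
    have h3 : ∀ i, i ∉ S → y₁ i = w₁ i := fun i hi => (hout i hi).2.1
    have h4 : ∀ i, i ∉ S → y₂ i = w₂ i := fun i hi => (hout i hi).2.2
    have hprod : ∀ σ τ : Bool, (∏ i, if i ∈ S then
          pairing σ (site ((x₁, x₂), (y₁, y₂)) i) * pairing τ (site ((u₁, u₂), (w₁, w₂)) i)
        else if site ((x₁, x₂), (y₁, y₂)) i = site ((u₁, u₂), (w₁, w₂)) i then 1 else 0) =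
        (∏ i ∈ S, pairing σ (site ((x₁, x₂), (y₁, y₂)) i)) *
          ∏ i ∈ S, pairing τ (site ((u₁, u₂), (w₁, w₂)) i) := by
      intro σ τ
      rw [← Finset.prod_mul_distrib, ← Fintype.prod_ite_mem S]
      refine Finset.prod_congr rfl fun i _ => ?_
      split_ifs with hi h
      · rfl
      · rfl
      · exact absurd (by simp [site, h1 i hi, h2 i hi, h3 i hi, h4 i hi]) h
    have hcard : (Fintype.card (Config S q) : ℂ) = (q : ℂ) ^ S.card := by simp
    -- Nonemptiness of `S` makes the gate dimension at least `2`, so the Weingarten denominator may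
    -- be divided out.
    have hne : (q : ℂ) ^ S.card * (((q : ℂ) ^ S.card) ^ 2 - 1) ≠ 0 := by
      have h2 : 1 < q ^ S.card := Nat.one_lt_pow hS.card_ne_zero (by omega)
      have h3 : 1 < (q ^ S.card) ^ 2 := Nat.one_lt_pow two_ne_zero h2
      refine mul_ne_zero ?_ (sub_ne_zero.mpr ?_)
      · exact_mod_cast (by omega : q ^ S.card ≠ 0)
      · exact_mod_cast h3.ne'
    have key := integral_unitary_second_moment (n := Config S q)
      (fun i => u₁ i) (fun i => u₂ i) (fun i => w₁ i) (fun i => w₂ i)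
      (fun i => x₁ i) (fun i => x₂ i) (fun i => y₁ i) (fun i => y₂ i)
    rw [hcard] at key
    simp only [funext_iff, Subtype.forall] at key
    simp only [secondMoment, vecConj, gate, Matrix.of_apply, Matrix.kroneckerMap_apply,
      Matrix.map_apply, if_pos h1, if_pos h2, if_pos h3, if_pos h4, if_true, hprod, prod_pairing,
      Fintype.sum_bool, weingarten, Bool.false_eq_true, Bool.true_eq_false, if_false]
    rw [eq_div_of_mul_eq hne ((mul_comm _ _).trans key)]
    ring
  · obtain ⟨i, hi, hne⟩ : ∃ i, i ∉ S ∧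
        ¬ ((x₁ i = u₁ i ∧ x₂ i = u₂ i) ∧ y₁ i = w₁ i ∧ y₂ i = w₂ i) := by
      push Not at hout
      obtain ⟨i, hi, h⟩ := hout
      exact ⟨i, hi, fun h' => h h'.1 h'.2.1 h'.2.2⟩
    have hR : ∀ σ τ : Bool, (∏ i, if i ∈ S then
          pairing σ (site ((x₁, x₂), (y₁, y₂)) i) * pairing τ (site ((u₁, u₂), (w₁, w₂)) i)
        else if site ((x₁, x₂), (y₁, y₂)) i = site ((u₁, u₂), (w₁, w₂)) i then (1 : ℂ) else 0)
        = 0 := by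
      intro σ τ
      refine Finset.prod_eq_zero (Finset.mem_univ i) ?_
      rw [if_neg hi, if_neg]
      simpa [site] using hne
    simp only [hR, mul_zero, Finset.sum_const_zero]
    have hz : ∀ U : Matrix (Config S q) (Config S q) ℂ,
        vecConj (gate S U) ((x₁, x₂), (y₁, y₂)) ((u₁, u₂), (w₁, w₂)) = 0 := by
      intro U
      simp only [vecConj, gate, Matrix.of_apply, Matrix.kroneckerMap_apply, Matrix.map_apply]
      by_cases h1 : x₁ i = u₁ i
      · by_cases h2 : x₂ i = u₂ i
        · by_cases h3 : y₁ i = w₁ i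
          · have h4 : y₂ i ≠ w₂ i := fun h4 => hne ⟨⟨h1, h2⟩, h3, h4⟩
            rw [if_neg fun h : ∀ i, i ∉ S → y₂ i = w₂ i => h4 (h i hi)]; simp
          · rw [if_neg fun h : ∀ i, i ∉ S → y₁ i = w₁ i => h3 (h i hi)]; simp
        · rw [if_neg fun h : ∀ i, i ∉ S → x₂ i = u₂ i => h2 (h i hi)]; simp
      · rw [if_neg fun h : ∀ i, i ∉ S → x₁ i = u₁ i => h1 (h i hi)]; simp
    simp [secondMoment, hz]

/-- The action of a second moment operator on product vectors. -/
theorem secondMoment_mulVec_productVec {S : Finset (Fin N)} (hq : 2 ≤ q) (hS : S.Nonempty)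
    (h : Fin N → SiteIndex q → ℂ) :
    secondMoment N q S *ᵥ productVec h = ∑ σ,
      (∑ τ, weingarten ((q : ℂ) ^ S.card) σ τ * ∏ i ∈ S, ∑ s, pairing τ s * h i s) •
        productVec fun i => if i ∈ S then pairing σ else h i := by
  ext a
  simp only [Matrix.mulVec, dotProduct, secondMoment_apply hq hS, Finset.sum_apply, Pi.smul_apply,
    smul_eq_mul, Finset.sum_mul, mul_assoc]
  rw [Finset.sum_comm]
  refine Finset.sum_congr rfl fun σ _ => ?_
  rw [Finset.sum_comm]
  refine Finset.sum_congr rfl fun τ _ => ?_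
  rw [← Finset.mul_sum]
  congr 1
  simp only [productVec, ← Finset.prod_mul_distrib]
  rw [sum_prod_site (fun i s => (if i ∈ S then pairing σ (site a i) * pairing τ s
    else if site a i = s then 1 else 0) * h i s), ← Fintype.prod_ite_mem S,
    ← Finset.prod_mul_distrib]
  refine Finset.prod_congr rfl fun i _ => ?_
  split_ifs with hi
  · rw [mul_comm, Finset.mul_sum]
    exact Finset.sum_congr rfl fun s _ => by ring
  · simp

theorem sum_pairing_mul_pairing (σ τ : Bool) :
    ∑ s : SiteIndex q, pairing τ s * pairing σ s = if σ = τ then (q : ℂ) ^ 2 else q := by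
  cases σ <;> cases τ <;>
    simp [pairing, Fintype.sum_prod_type, ite_and, sq, Finset.sum_ite_irrel]

/-- The gate on `T` writes one label on all of `T`; the gate on `S` then overwrites the sites of
`S`. Every site outside `S` lies in `T` and keeps the first label. -/
theorem secondMoment_mulVec_mem_span {S T : Finset (Fin N)} (hq : 2 ≤ q) (hS : S.Nonempty)
    (hT : T.Nonempty) (hST : ∀ i, i ∉ S → i ∈ T) (u : VecIndex N q → ℂ) :
    secondMoment N q S *ᵥ (secondMoment N q T *ᵥ u) ∈
      Submodule.span ℂ (Set.range fun p : Bool × Bool =>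
        (permVec fun i => if i ∈ S then p.1 else p.2 : VecIndex N q → ℂ)) := by
  have hu : u = ∑ b, u b • productVec (fun i s => if s = site b i then (1 : ℂ) else 0) := by
    ext a
    simp [productVec, prod_site_eq]
  rw [hu]
  simp only [Matrix.mulVec_sum, Matrix.mulVec_smul, secondMoment_mulVec_productVec hq hT,
    secondMoment_mulVec_productVec hq hS]
  refine Submodule.sum_mem _ fun b _ => Submodule.smul_mem _ _ <| Submodule.sum_mem _ fun σ _ =>
    Submodule.smul_mem _ _ <| Submodule.sum_mem _ fun τ _ => Submodule.smul_mem _ _ <|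
      Submodule.subset_span ⟨(τ, σ), ?_⟩
  simp only [permVec]
  congr 1
  ext i s
  by_cases hi : i ∈ S
  · simp [hi]
  · simp [hi, hST i hi]

/-- The coefficient of the identity in the second moment of the tensor product of the identity
in dimension `m` and the swap in dimension `n`. -/
def kappa (m n : ℂ) : ℂ := n * (m ^ 2 - 1) / ((m * n) ^ 2 - 1)

theorem secondMoment_mulVec_permVec {S : Finset (Fin N)} (hq : 2 ≤ q) (hS : S.Nonempty)
    (f : Fin N → Bool) :
    secondMoment N q S *ᵥ permVec f = ∑ σ,
      kappa (∏ i ∈ S, if f i = σ then (q : ℂ) else 1) (∏ i ∈ S, if f i = !σ then (q : ℂ) else 1) •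
        (permVec fun i => if i ∈ S then σ else f i : VecIndex N q → ℂ) := by
  rw [permVec, secondMoment_mulVec_productVec hq hS]
  refine Finset.sum_congr rfl fun σ _ => ?_
  have hv : (productVec fun i => if i ∈ S then pairing σ else pairing (f i) :
      VecIndex N q → ℂ) = permVec fun i => if i ∈ S then σ else f i := by
    simp only [permVec, apply_ite pairing]
  rw [hv]
  congr 1
  simp only [sum_pairing_mul_pairing]
  have hsum : ∀ F : Bool → ℂ, ∑ τ, F τ = F σ + F (!σ) := by
    intro F; cases σ <;> simp [add_comm]
  set m := ∏ i ∈ S, if f i = σ then (q : ℂ) else 1 with hm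
  set n := ∏ i ∈ S, if f i = !σ then (q : ℂ) else 1 with hn
  -- Here `m` and `n` are the total dimensions of the sites labelled `σ` and `!σ`; a pairing
  -- overlaps itself in `q ^ 2` and the other one in `q`.
  have h1 : ∏ i ∈ S, (if f i = σ then (q : ℂ) ^ 2 else q) = m ^ 2 * n := by
    rw [hm, hn, ← Finset.prod_pow, ← Finset.prod_mul_distrib]
    refine Finset.prod_congr rfl fun i _ => ?_
    cases f i <;> cases σ <;> simp
  have h2 : ∏ i ∈ S, (if f i = !σ then (q : ℂ) ^ 2 else q) = m * n ^ 2 := by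
    rw [hm, hn, ← Finset.prod_pow, ← Finset.prod_mul_distrib]
    refine Finset.prod_congr rfl fun i _ => ?_
    cases f i <;> cases σ <;> simp
  have h3 : (q : ℂ) ^ S.card = m * n := by
    rw [hm, hn, ← Finset.prod_mul_distrib, ← Finset.prod_const]
    refine Finset.prod_congr rfl fun i _ => ?_
    cases f i <;> cases σ <;> simp
  have hne : m * n ≠ 0 := by
    rw [← h3]
    exact pow_ne_zero _ (by exact_mod_cast (by omega : q ≠ 0))
  have hm0 := left_ne_zero_of_mul hne
  have hn0 := right_ne_zero_of_mul hne
  rw [hsum, h1, h2, h3]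
  simp only [weingarten, kappa, if_true, Bool.eq_not_self, if_false]
  rw [← div_div]
  field_simp
  ring

end Product

/-! ### Reduced vectors and the spectrum on the image of the circuits. -/

section Triple

variable {M q : ℕ}

/-- The permutation vector with `α` on the first site, `β` on the second site and `γ` on all the
others. -/
def tripleVec (M q : ℕ) (α β γ : Bool) : VecIndex (M + 2) q → ℂ :=
  permVec fun i => if i.val = 0 then α else if i.val = 1 then β else γ

theorem G₁_mulVec_tripleVec (hq : 2 ≤ q) (α β γ : Bool) :
    G₁ (M + 2) q *ᵥ tripleVec M q α β γ = ∑ σ : Bool,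
      kappa ((if β = σ then (q : ℂ) else 1) * (if γ = σ then (q : ℂ) else 1) ^ M)
        ((if β = !σ then (q : ℂ) else 1) * (if γ = !σ then (q : ℂ) else 1) ^ M) •
        tripleVec M q α σ σ := by
  rw [G₁, tripleVec, secondMoment_mulVec_permVec hq ⟨1, by simp⟩]
  refine Finset.sum_congr rfl fun σ _ => ?_
  congr 1
  · simp [Finset.prod_filter, Fin.prod_univ_succ]
  · simp only [tripleVec]
    congr 1
    ext i
    by_cases h0 : i.val = 0 <;> simp [h0, -Fin.val_eq_zero_iff]

theorem G₂_mulVec_tripleVec (hq : 2 ≤ q) (α β γ : Bool) :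
    G₂ (M + 2) q *ᵥ tripleVec M q α β γ = ∑ σ : Bool,
      kappa ((if α = σ then (q : ℂ) else 1) * (if β = σ then (q : ℂ) else 1))
        ((if α = !σ then (q : ℂ) else 1) * (if β = !σ then (q : ℂ) else 1)) •
        tripleVec M q σ σ γ := by
  rw [G₂, tripleVec, secondMoment_mulVec_permVec hq ⟨0, by simp⟩]
  refine Finset.sum_congr rfl fun σ _ => ?_
  congr 1
  · simp [Finset.prod_filter, Fin.prod_univ_succ]
  · simp only [tripleVec]
    congr 1
    ext i
    by_cases h0 : i.val = 0 <;> by_cases h1 : i.val = 1 <;> simp [h0, h1, -Fin.val_eq_zero_iff]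

theorem G₃_mulVec_tripleVec (hq : 2 ≤ q) (α β γ : Bool) :
    G₃ (M + 2) q *ᵥ tripleVec M q α β γ = ∑ σ : Bool,
      kappa ((if α = σ then (q : ℂ) else 1) * (if γ = σ then (q : ℂ) else 1) ^ M)
        ((if α = !σ then (q : ℂ) else 1) * (if γ = !σ then (q : ℂ) else 1) ^ M) •
        tripleVec M q σ β σ := by
  rw [G₃, tripleVec, secondMoment_mulVec_permVec hq ⟨0, by simp⟩]
  refine Finset.sum_congr rfl fun σ _ => ?_
  congr 1
  · simp [Finset.prod_filter, Fin.prod_univ_succ]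
  · simp only [tripleVec]
    congr 1
    ext i
    by_cases h0 : i.val = 0 <;> by_cases h1 : i.val = 1 <;> simp [h0, h1, -Fin.val_eq_zero_iff]

theorem sum_bool_eq_add_not {E : Type*} [AddCommMonoid E] (σ : Bool) (F : Bool → E) :
    ∑ τ, F τ = F σ + F (!σ) := by
  cases σ <;> simp [add_comm]

theorem sq_sub_one_ne_zero {k : ℕ} (hk : 2 ≤ k) : (k : ℂ) ^ 2 - 1 ≠ 0 := by
  refine sub_ne_zero.mpr ?_
  exact_mod_cast (Nat.one_lt_pow two_ne_zero hk).ne'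

theorem kappa_one_right {m : ℂ} (hm : m ^ 2 - 1 ≠ 0) : kappa m 1 = 1 := by
  simp [kappa, hm]

theorem kappa_one_left (n : ℂ) : kappa 1 n = 0 := by
  simp [kappa]

/-- Averaging over a subsystem and then over the whole equals averaging over the whole. This is the
coefficient of one label; `kappa_mul_kappa_add_kappa` is that of the other. -/
theorem kappa_mul_kappa_mul {a b : ℂ} (c : ℂ) (hab : (a * b) ^ 2 - 1 ≠ 0) :
    kappa a b * kappa (a * b) c = kappa a (b * c) := by
  simp only [kappa]
  rw [div_mul_div_comm, ← mul_assoc a b c,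
    show b * (a ^ 2 - 1) * (c * ((a * b) ^ 2 - 1)) =
      ((a * b) ^ 2 - 1) * (b * c * (a ^ 2 - 1)) by ring, mul_div_mul_left _ _ hab]

theorem kappa_mul_kappa_add_kappa {a b c : ℂ} (hab : (a * b) ^ 2 - 1 ≠ 0)
    (habc : (a * b * c) ^ 2 - 1 ≠ 0) :
    kappa a b * kappa c (a * b) + kappa b a = kappa (b * c) a := by
  have h1 : (b * a) ^ 2 - 1 ≠ 0 := by rwa [mul_comm]
  have h2 : (c * (a * b)) ^ 2 - 1 ≠ 0 := by rwa [mul_comm]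
  have h3 : (b * c * a) ^ 2 - 1 ≠ 0 := by rwa [mul_comm, ← mul_assoc]
  simp only [kappa]
  rw [div_mul_div_comm, div_add_div _ _ (mul_ne_zero hab h2) h1,
    div_eq_div_iff (mul_ne_zero (mul_ne_zero hab h2) h1) h3]
  ring

theorem G₁_mulVec_tripleVec_same (hq : 2 ≤ q) (α σ : Bool) :
    G₁ (M + 2) q *ᵥ tripleVec M q α σ σ = tripleVec M q α σ σ := by
  have h : ((q : ℂ) * q ^ M) ^ 2 - 1 ≠ 0 := by
    rw [← pow_succ']
    exact_mod_cast sq_sub_one_ne_zero (k := q ^ (M + 1))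
      (Nat.one_lt_pow M.succ_ne_zero (by omega))
  rw [G₁_mulVec_tripleVec hq, sum_bool_eq_add_not σ]
  simp [kappa_one_right h, kappa_one_left]

theorem G₂_mulVec_tripleVec_same (hq : 2 ≤ q) (σ γ : Bool) :
    G₂ (M + 2) q *ᵥ tripleVec M q σ σ γ = tripleVec M q σ σ γ := by
  have h : ((q : ℂ) * q) ^ 2 - 1 ≠ 0 := by
    exact_mod_cast sq_sub_one_ne_zero (k := q * q) (by nlinarith)
  rw [G₂_mulVec_tripleVec hq, sum_bool_eq_add_not σ]
  simp [kappa_one_right h, kappa_one_left]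

theorem G₃_mulVec_tripleVec_same (hq : 2 ≤ q) (σ β : Bool) :
    G₃ (M + 2) q *ᵥ tripleVec M q σ β σ = tripleVec M q σ β σ := by
  have h : ((q : ℂ) * q ^ M) ^ 2 - 1 ≠ 0 := by
    rw [← pow_succ']
    exact_mod_cast sq_sub_one_ne_zero (k := q ^ (M + 1))
      (Nat.one_lt_pow M.succ_ne_zero (by omega))
  rw [G₃_mulVec_tripleVec hq, sum_bool_eq_add_not σ]
  simp [kappa_one_right h, kappa_one_left]

/-- The vector with `σ` on the first site and `!σ` elsewhere, minus its global projection. -/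
def reducedFirst (M q : ℕ) (σ : Bool) : VecIndex (M + 2) q → ℂ :=
  tripleVec M q σ (!σ) (!σ) -
    (kappa q (q * q ^ M) • tripleVec M q σ σ σ + kappa (q * q ^ M) q • tripleVec M q (!σ) (!σ) (!σ))

/-- The vector with `σ` on the second site and `!σ` elsewhere, minus its global projection. -/
def reducedSecond (M q : ℕ) (σ : Bool) : VecIndex (M + 2) q → ℂ :=
  tripleVec M q (!σ) σ (!σ) -
    (kappa q (q * q ^ M) • tripleVec M q σ σ σ + kappa (q * q ^ M) q • tripleVec M q (!σ) (!σ) (!σ))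

/-- The vector with `σ` on the first two sites and `!σ` elsewhere, minus its global projection. -/
def reducedBoth (M q : ℕ) (σ : Bool) : VecIndex (M + 2) q → ℂ :=
  tripleVec M q σ σ (!σ) -
    (kappa (q * q) (q ^ M) • tripleVec M q σ σ σ +
      kappa (q ^ M) (q * q) • tripleVec M q (!σ) (!σ) (!σ))

theorem kappa_relations (hq : 2 ≤ q) (M : ℕ) :
    (kappa q q * kappa (q * q) (q ^ M) = kappa q (q * q ^ M) ∧
      kappa q q * kappa (q ^ M) (q * q) + kappa q q = kappa (q * q ^ M) q) ∧
    (kappa (q ^ M) q * kappa (q * q ^ M) q = kappa (q ^ M) (q * q) ∧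
      kappa (q ^ M) q * kappa q (q * q ^ M) + kappa q (q ^ M) = kappa (q * q) (q ^ M)) ∧
    (kappa q (q ^ M) * kappa (q * q ^ M) q = kappa q (q * q ^ M) ∧
      kappa q (q ^ M) * kappa q (q * q ^ M) + kappa (q ^ M) q = kappa (q * q ^ M) q) := by
  have h2 : ((q : ℂ) * q) ^ 2 - 1 ≠ 0 := by
    exact_mod_cast sq_sub_one_ne_zero (k := q * q) (by nlinarith)
  have h1 : ((q : ℂ) * q ^ M) ^ 2 - 1 ≠ 0 := by
    rw [← pow_succ']
    exact_mod_cast sq_sub_one_ne_zero (k := q ^ (M + 1))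
      (Nat.one_lt_pow M.succ_ne_zero (by omega))
  have h3 : ((q : ℂ) * q * q ^ M) ^ 2 - 1 ≠ 0 := by
    rw [mul_assoc, ← pow_succ', ← pow_succ']
    exact_mod_cast sq_sub_one_ne_zero (k := q ^ (M + 2))
      (Nat.one_lt_pow (by omega) (by omega))
  have h1' : ((q : ℂ) ^ M * q) ^ 2 - 1 ≠ 0 := by rwa [mul_comm]
  have h3' : ((q : ℂ) ^ M * q * q) ^ 2 - 1 ≠ 0 := by rwa [mul_comm _ (q : ℂ), mul_comm _ (q : ℂ),
    ← mul_assoc]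
  have h3'' : ((q : ℂ) * q ^ M * q) ^ 2 - 1 ≠ 0 := by rwa [mul_comm _ (q : ℂ), ← mul_assoc]
  refine ⟨⟨kappa_mul_kappa_mul _ h2, kappa_mul_kappa_add_kappa h2 h3⟩, ⟨?_, ?_⟩, ⟨?_, ?_⟩⟩
  · rw [mul_comm (q : ℂ) (q ^ M), kappa_mul_kappa_mul _ h1']
  · rw [mul_comm (q : ℂ) (q ^ M), kappa_mul_kappa_add_kappa h1' h3']
  · rw [kappa_mul_kappa_mul _ h1, mul_comm (q : ℂ) (q ^ M)]
  · rw [kappa_mul_kappa_add_kappa h1 h3'', mul_comm (q : ℂ) (q ^ M)]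

/-- `G₂` sends the leading vector to two terms. One is globally constant and is absorbed by the
subtracted projection; the other leads `reducedBoth`. The further rules for `G₁` and `G₃` follow the
same pattern. -/
theorem G₂_mulVec_reducedFirst (hq : 2 ≤ q) (σ : Bool) :
    G₂ (M + 2) q *ᵥ reducedFirst M q σ = kappa q q • reducedBoth M q σ := by
  obtain ⟨⟨h1, h2⟩, -, -⟩ := kappa_relations hq M
  simp only [reducedFirst, Matrix.mulVec_sub, Matrix.mulVec_add, Matrix.mulVec_smul,
    G₂_mulVec_tripleVec_same hq, G₂_mulVec_tripleVec hq σ (!σ) (!σ), sum_bool_eq_add_not σ,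
    reducedBoth]
  simp only [Bool.not_not, Bool.not_eq_self, Bool.eq_not_self, if_true, if_false, mul_one, one_mul,
    ← h1, ← h2]
  module

theorem G₂_mulVec_reducedSecond (hq : 2 ≤ q) (σ : Bool) :
    G₂ (M + 2) q *ᵥ reducedSecond M q σ = kappa q q • reducedBoth M q σ := by
  obtain ⟨⟨h1, h2⟩, -, -⟩ := kappa_relations hq M
  simp only [reducedSecond, Matrix.mulVec_sub, Matrix.mulVec_add, Matrix.mulVec_smul,
    G₂_mulVec_tripleVec_same hq, G₂_mulVec_tripleVec hq (!σ) σ (!σ), sum_bool_eq_add_not σ,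
    reducedBoth]
  simp only [Bool.not_not, Bool.not_eq_self, Bool.eq_not_self, if_true, if_false, mul_one, one_mul,
    ← h1, ← h2]
  module

theorem G₁_mulVec_reducedBoth (hq : 2 ≤ q) (σ : Bool) :
    G₁ (M + 2) q *ᵥ reducedBoth M q σ = kappa (q ^ M) q • reducedFirst M q σ := by
  obtain ⟨-, ⟨h1, h2⟩, -⟩ := kappa_relations hq M
  simp only [reducedBoth, Matrix.mulVec_sub, Matrix.mulVec_add, Matrix.mulVec_smul,
    G₁_mulVec_tripleVec_same hq, G₁_mulVec_tripleVec hq σ σ (!σ), sum_bool_eq_add_not σ,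
    reducedFirst]
  simp only [Bool.not_not, Bool.not_eq_self, Bool.eq_not_self, if_true, if_false, mul_one, one_mul,
    one_pow, ← h1, ← h2]
  module

theorem G₃_mulVec_reducedBoth (hq : 2 ≤ q) (σ : Bool) :
    G₃ (M + 2) q *ᵥ reducedBoth M q σ = kappa (q ^ M) q • reducedSecond M q σ := by
  obtain ⟨-, ⟨h1, h2⟩, -⟩ := kappa_relations hq M
  simp only [reducedBoth, Matrix.mulVec_sub, Matrix.mulVec_add, Matrix.mulVec_smul,
    G₃_mulVec_tripleVec_same hq, G₃_mulVec_tripleVec hq σ σ (!σ), sum_bool_eq_add_not σ,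
    reducedSecond]
  simp only [Bool.not_not, Bool.not_eq_self, Bool.eq_not_self, if_true, if_false, mul_one, one_mul,
    one_pow, ← h1, ← h2]
  module

theorem G₁_mulVec_reducedFirst (hq : 2 ≤ q) (σ : Bool) :
    G₁ (M + 2) q *ᵥ reducedFirst M q σ = reducedFirst M q σ := by
  simp only [reducedFirst, Matrix.mulVec_sub, Matrix.mulVec_add, Matrix.mulVec_smul,
    G₁_mulVec_tripleVec_same hq]

theorem G₃_mulVec_reducedFirst (hq : 2 ≤ q) (σ : Bool) :
    G₃ (M + 2) q *ᵥ reducedFirst M q σ = kappa q (q ^ M) • reducedSecond M q (!σ) := by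
  obtain ⟨-, -, h1, h2⟩ := kappa_relations hq M
  simp only [reducedFirst, Matrix.mulVec_sub, Matrix.mulVec_add, Matrix.mulVec_smul,
    G₃_mulVec_tripleVec_same hq, G₃_mulVec_tripleVec hq σ (!σ) (!σ), sum_bool_eq_add_not σ,
    reducedSecond]
  simp only [Bool.not_not, Bool.not_eq_self, Bool.eq_not_self, if_true, if_false, mul_one, one_mul,
    one_pow]
  match_scalars
  · ring
  · linear_combination h2
  · linear_combination h1

theorem G₁_mulVec_reducedSecond (hq : 2 ≤ q) (σ : Bool) :
    G₁ (M + 2) q *ᵥ reducedSecond M q σ = kappa q (q ^ M) • reducedFirst M q (!σ) := by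
  obtain ⟨-, -, h1, h2⟩ := kappa_relations hq M
  simp only [reducedSecond, Matrix.mulVec_sub, Matrix.mulVec_add, Matrix.mulVec_smul,
    G₁_mulVec_tripleVec_same hq, G₁_mulVec_tripleVec hq (!σ) σ (!σ), sum_bool_eq_add_not σ,
    reducedFirst]
  simp only [Bool.not_not, Bool.not_eq_self, Bool.eq_not_self, if_true, if_false, mul_one, one_mul,
    one_pow]
  match_scalars
  · ring
  · linear_combination h2
  · linear_combination h1

theorem circuitC_mulVec_reducedFirst (hq : 2 ≤ q) (σ : Bool) :
    circuitC (M + 2) q *ᵥ reducedFirst M q σ =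
      ((kappa q q * kappa (q ^ M) q) ^ 2) • reducedFirst M q σ := by
  simp only [circuitC, ← Matrix.mulVec_mulVec, Matrix.mulVec_smul, G₁_mulVec_reducedFirst hq,
    G₂_mulVec_reducedFirst hq, G₃_mulVec_reducedBoth hq, G₂_mulVec_reducedSecond hq,
    G₁_mulVec_reducedBoth hq, smul_smul]
  congr 1
  ring

theorem circuitC'_mulVec_reducedFirst (hq : 2 ≤ q) (σ : Bool) :
    circuitC' (M + 2) q *ᵥ reducedFirst M q σ = (kappa q (q ^ M) ^ 2) • reducedFirst M q σ := by
  simp only [circuitC', ← Matrix.mulVec_mulVec, Matrix.mulVec_smul, G₁_mulVec_reducedFirst hq,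
    G₃_mulVec_reducedFirst hq, G₁_mulVec_reducedSecond hq, smul_smul, Bool.not_not, sq]

theorem reducedFirst_ne_zero (hq : 2 ≤ q) (M : ℕ) : reducedFirst M q true ≠ 0 := by
  intro h
  let o : Fin q := ⟨0, by omega⟩
  let l : Fin q := ⟨1, by omega⟩
  have hol : o ≠ l := by simp [o, l]
  -- On the first site these indices match the identity pairing but not the swap, and on all others
  -- the reverse, so only the leading term is nonzero at `a`.
  let a : VecIndex (M + 2) q :=
    ((fun _ => o, fun _ => l), (fun i => if i.val = 0 then o else l,
      fun i => if i.val = 0 then l else o))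
  have h := congr_fun h a
  have e0 : ∀ f : Fin (M + 2) → Bool, permVec f a =
      (if f 0 then 1 else 0) * ∏ i : Fin (M + 1), if f i.succ then (0 : ℂ) else 1 := by
    intro f
    rw [permVec, productVec, Fin.prod_univ_succ]
    congr 1
  simp [reducedFirst, tripleVec, e0] at h

/-- Vectors that are products of an identity or a swap on the first site and on the others. -/
def firstSpan (M q : ℕ) : Submodule ℂ (VecIndex (M + 2) q → ℂ) :=
  Submodule.span ℂ (Set.range fun p : Bool × Bool => tripleVec M q p.1 p.2 p.2)

theorem G₁_mulVec_mulVec_mem_firstSpan {T : Finset (Fin (M + 2))} (hq : 2 ≤ q) (hT : 0 ∈ T)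
    (u : VecIndex (M + 2) q → ℂ) :
    G₁ (M + 2) q *ᵥ (secondMoment (M + 2) q T *ᵥ u) ∈ firstSpan M q := by
  have h := secondMoment_mulVec_mem_span (S := {i : Fin (M + 2) | i.val ≠ 0}) (T := T) hq
    ⟨1, by simp⟩ ⟨0, hT⟩ (fun i hi => by
      have : i = 0 := Fin.ext (by simpa using hi)
      exact this ▸ hT) u
  refine Submodule.span_mono ?_ h
  rintro _ ⟨p, rfl⟩
  refine ⟨(p.2, p.1), ?_⟩
  simp only [tripleVec]
  congr 1
  ext i
  by_cases h0 : i.val = 0 <;> simp [h0, -Fin.val_eq_zero_iff]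

theorem circuitC_mulVec_mem_firstSpan (hq : 2 ≤ q) (u : VecIndex (M + 2) q → ℂ) :
    circuitC (M + 2) q *ᵥ u ∈ firstSpan M q := by
  simp only [circuitC, mul_assoc, ← Matrix.mulVec_mulVec]
  exact G₁_mulVec_mulVec_mem_firstSpan hq (by simp) _

theorem circuitC'_mulVec_mem_firstSpan (hq : 2 ≤ q) (u : VecIndex (M + 2) q → ℂ) :
    circuitC' (M + 2) q *ᵥ u ∈ firstSpan M q := by
  simp only [circuitC', mul_assoc, ← Matrix.mulVec_mulVec]
  exact G₁_mulVec_mulVec_mem_firstSpan hq (by simp) _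

/-- On `firstSpan`, `A` satisfies `(A - 1)(A - λ) = 0`, and an eigenvector of nonzero eigenvalue is
a multiple of its image, hence lies in `firstSpan`. The eigenvalue `0` is covered by `0 ≤ λ`. -/
theorem isLargestNonUnitEigenvalue_of_firstSpan
    {A : Matrix (VecIndex (M + 2) q) (VecIndex (M + 2) q) ℂ} {lam : ℝ} (hq : 2 ≤ q)
    (h0 : 0 ≤ lam) (h1 : lam ≠ 1) (hA : ∀ u, A *ᵥ u ∈ firstSpan M q)
    (hfix : ∀ σ, A *ᵥ tripleVec M q σ σ σ = tripleVec M q σ σ σ)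
    (he : ∀ σ, A *ᵥ reducedFirst M q σ = (lam : ℂ) • reducedFirst M q σ) :
    IsLargestNonUnitEigenvalue A lam := by
  refine ⟨⟨?_, by exact_mod_cast h1⟩, ?_⟩
  · refine Module.End.hasEigenvalue_of_hasEigenvector (x := reducedFirst M q true)
      (Module.End.hasEigenvector_iff.mpr ⟨Module.End.mem_eigenspace_iff.mpr ?_,
        reducedFirst_ne_zero hq M⟩)
    rw [Matrix.toLin'_apply, he]
  · rintro z ⟨hz, hz1⟩
    obtain ⟨v, hv, hv0⟩ := hz.exists_hasEigenvector
    rw [Module.End.mem_eigenspace_iff, Matrix.toLin'_apply] at hv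
    by_cases hz0 : z = 0
    · simpa [hz0] using h0
    have hW : ∀ w ∈ firstSpan M q,
        A *ᵥ (A *ᵥ w - (lam : ℂ) • w) = A *ᵥ w - (lam : ℂ) • w := by
      intro w hw
      induction hw using Submodule.span_induction with
      | mem w hw =>
        obtain ⟨⟨σ, τ⟩, rfl⟩ := hw
        by_cases hστ : τ = σ
        · subst hστ
          simp only [Matrix.mulVec_sub, Matrix.mulVec_smul, hfix]
        · obtain rfl : τ = !σ := by cases σ <;> cases τ <;> simp_all
          have hw : tripleVec M q σ (!σ) (!σ) = reducedFirst M q σ +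
              (kappa q (q * q ^ M) • tripleVec M q σ σ σ +
                kappa (q * q ^ M) q • tripleVec M q (!σ) (!σ) (!σ)) := by
            rw [reducedFirst]; abel
          simp only [hw, Matrix.mulVec_sub, Matrix.mulVec_add, Matrix.mulVec_smul, hfix, he]
          module
      | zero => simp
      | add x y _ _ hx hy =>
        simp only [Matrix.mulVec_add, Matrix.mulVec_sub, smul_add, Matrix.mulVec_smul] at hx hy ⊢
        linear_combination (exp := 1) hx + hy
      | smul c x _ hx =>
        have := congrArg (c • ·) hx
        simp only [Matrix.mulVec_sub, Matrix.mulVec_smul, smul_sub, smul_comm c] at this ⊢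
        exact this
    have hvW : v ∈ firstSpan M q := by
      have := (firstSpan M q).smul_mem z⁻¹ (hA v)
      rwa [hv, smul_smul, inv_mul_cancel₀ hz0, one_smul] at this
    have h := hW v hvW
    rw [hv, ← sub_smul, Matrix.mulVec_smul, hv, smul_smul] at h
    have h' : ((z - lam) * (z - 1)) • v = 0 := by
      rw [mul_sub, mul_one, sub_smul, h, sub_self]
    rcases smul_eq_zero.mp h' with h' | h'
    · rcases mul_eq_zero.mp h' with h' | h'
      · rw [sub_eq_zero.mp h', Complex.norm_real, Real.norm_of_nonneg h0]
      · exact absurd (sub_eq_zero.mp h') hz1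
    · exact absurd h' hv0

end Triple

/-! ### Closed forms of the eigenvalues. -/

section Eigenvalue

variable {M q : ℕ}

theorem circuitC_mulVec_tripleVec_same (hq : 2 ≤ q) (σ : Bool) :
    circuitC (M + 2) q *ᵥ tripleVec M q σ σ σ = tripleVec M q σ σ σ := by
  simp only [circuitC, ← Matrix.mulVec_mulVec, G₁_mulVec_tripleVec_same hq,
    G₂_mulVec_tripleVec_same hq, G₃_mulVec_tripleVec_same hq]

theorem circuitC'_mulVec_tripleVec_same (hq : 2 ≤ q) (σ : Bool) :
    circuitC' (M + 2) q *ᵥ tripleVec M q σ σ σ = tripleVec M q σ σ σ := by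
  simp only [circuitC', ← Matrix.mulVec_mulVec, G₁_mulVec_tripleVec_same hq,
    G₃_mulVec_tripleVec_same hq]

/-- With `Q = q`, `C = q ^ M` and `N = M + 2`, the right side is `kappa q q * kappa (q ^ M) q`. -/
theorem eigenvalue_eq {Q C : ℝ} (hQ : 2 ≤ Q) (hC : 1 ≤ C) :
    (Q ^ 4 * C ^ 2 - Q ^ 4) / (Q ^ 4 * C ^ 2 - Q ^ 2) * (1 / (Q ^ 2 + 1)) =
      Q * (Q ^ 2 - 1) / ((Q * Q) ^ 2 - 1) * (Q * (C ^ 2 - 1) / ((C * Q) ^ 2 - 1)) := by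
  have hQC : 2 ≤ C * Q := by nlinarith
  have h1 : (C * Q) ^ 2 - 1 ≠ 0 := by nlinarith
  have h2 : Q ^ 2 - 1 ≠ 0 := by nlinarith
  have h3 : Q ≠ 0 := by positivity
  have h4 : Q ^ 4 * C ^ 2 - Q ^ 2 = Q ^ 2 * ((C * Q) ^ 2 - 1) := by ring
  have h5 : (Q * Q) ^ 2 - 1 = (Q ^ 2 - 1) * (Q ^ 2 + 1) := by ring
  have h6 : Q ^ 2 + 1 ≠ 0 := by positivity
  rw [h4, h5]
  field_simp

theorem eigenvalue_nonneg {Q C : ℝ} (hQ : 2 ≤ Q) (hC : 1 ≤ C) :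
    0 ≤ (Q ^ 4 * C ^ 2 - Q ^ 4) / (Q ^ 4 * C ^ 2 - Q ^ 2) * (1 / (Q ^ 2 + 1)) := by
  have hC2 : 1 ≤ C ^ 2 := one_le_pow₀ hC
  have hQ4 : 0 < Q ^ 4 := by positivity
  have hQ2 : Q ^ 2 ≤ Q ^ 4 := pow_le_pow_right₀ (by linarith) (by norm_num)
  have h1 : 0 ≤ Q ^ 4 * C ^ 2 - Q ^ 4 := by nlinarith
  have h2 : 0 ≤ Q ^ 4 * C ^ 2 - Q ^ 2 := by linarith
  positivity

theorem eigenvalue_lt_one {Q C : ℝ} (hQ : 2 ≤ Q) (hC : 1 ≤ C) :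
    (Q ^ 4 * C ^ 2 - Q ^ 4) / (Q ^ 4 * C ^ 2 - Q ^ 2) * (1 / (Q ^ 2 + 1)) < 1 := by
  have hC2 : 1 ≤ C ^ 2 := one_le_pow₀ hC
  have hQ4 : 0 < Q ^ 4 := by positivity
  have hQ2 : Q ^ 2 < Q ^ 4 := pow_lt_pow_right₀ (by linarith) (by norm_num)
  have h2 : 0 < Q ^ 4 * C ^ 2 - Q ^ 2 := by nlinarith
  have h3 : (Q ^ 4 * C ^ 2 - Q ^ 4) / (Q ^ 4 * C ^ 2 - Q ^ 2) ≤ 1 := by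
    rw [div_le_one h2]; linarith
  have h4 : 1 / (Q ^ 2 + 1) < 1 := by
    rw [div_lt_one (by positivity)]; nlinarith
  calc _ ≤ 1 * (1 / (Q ^ 2 + 1)) := mul_le_mul_of_nonneg_right h3 (by positivity)
    _ < 1 := by rwa [one_mul]

theorem isLargestNonUnitEigenvalue_circuitC {N q : ℕ} (hN : 2 ≤ N) (hq : 2 ≤ q) :
    IsLargestNonUnitEigenvalue (circuitC N q)
      ((((q : ℝ) ^ (2 * N) - (q : ℝ) ^ 4) / ((q : ℝ) ^ (2 * N) - (q : ℝ) ^ 2)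
        * (1 / ((q : ℝ) ^ 2 + 1))) ^ 2) := by
  obtain ⟨M, rfl⟩ := Nat.exists_eq_add_of_le' hN
  have hQ : (2 : ℝ) ≤ q := by exact_mod_cast hq
  have hC : (1 : ℝ) ≤ (q : ℝ) ^ M := one_le_pow₀ (by linarith)
  have hp : (q : ℝ) ^ (2 * (M + 2)) = (q : ℝ) ^ 4 * ((q : ℝ) ^ M) ^ 2 := by ring
  rw [hp]
  refine isLargestNonUnitEigenvalue_of_firstSpan hq (sq_nonneg _)
    (pow_lt_one₀ (eigenvalue_nonneg hQ hC) (eigenvalue_lt_one hQ hC) two_ne_zero).ne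
    (circuitC_mulVec_mem_firstSpan hq) (circuitC_mulVec_tripleVec_same hq) fun σ => ?_
  rw [circuitC_mulVec_reducedFirst hq, eigenvalue_eq hQ hC]
  simp [kappa]

theorem isLargestNonUnitEigenvalue_circuitC' {N q : ℕ} (hN : 3 ≤ N) (hq : 2 ≤ q) :
    IsLargestNonUnitEigenvalue (circuitC' N q)
      ((((q : ℝ) ^ 2 - 1) / ((q : ℝ) ^ N - (q : ℝ) ^ (2 - (N : ℤ)))) ^ 2) := by
  obtain ⟨M, rfl⟩ := Nat.exists_eq_add_of_le' (Nat.le_of_succ_le hN)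
  have hQ : (2 : ℝ) ≤ q := by exact_mod_cast hq
  -- This is where `N ≥ 3` matters: for `N = 2` one has `q ^ M = 1` and the formula gives the value
  -- `1`.
  have hC : (2 : ℝ) ≤ (q : ℝ) ^ M := hQ.trans (le_self_pow₀ (by linarith) (by omega))
  have hz : (q : ℝ) ^ (2 - ((M + 2 : ℕ) : ℤ)) = ((q : ℝ) ^ M)⁻¹ := by
    rw [show (2 - ((M + 2 : ℕ) : ℤ)) = -(M : ℤ) by push_cast; ring, zpow_neg, zpow_natCast]
  have hx : ((q : ℝ) ^ 2 - 1) / ((q : ℝ) ^ (M + 2) - (q : ℝ) ^ (2 - ((M + 2 : ℕ) : ℤ))) =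
      (q : ℝ) ^ M * ((q : ℝ) ^ 2 - 1) / (((q : ℝ) * (q : ℝ) ^ M) ^ 2 - 1) := by
    rw [hz, ← mul_div_mul_left _ _ (by positivity : (q : ℝ) ^ M ≠ 0),
      mul_sub _ ((q : ℝ) ^ (M + 2)), mul_inv_cancel₀ (by positivity)]
    ring
  rw [hx]
  set Q : ℝ := (q : ℝ) with hQdef
  set C : ℝ := Q ^ M with hCdef
  have hQC : 4 ≤ Q * C := by nlinarith
  have hd : 0 < (Q * C) ^ 2 - 1 := by nlinarith
  have hn : 0 ≤ C * (Q ^ 2 - 1) / ((Q * C) ^ 2 - 1) :=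
    div_nonneg (mul_nonneg (by linarith) (by nlinarith)) hd.le
  have hl : C * (Q ^ 2 - 1) / ((Q * C) ^ 2 - 1) < 1 := by
    rw [div_lt_one hd]
    -- Denominator minus numerator is `Q ^ 2 * C * (C - 1) + (C - 1)`.
    have : 0 ≤ Q ^ 2 * (C * (C - 1)) :=
      mul_nonneg (by positivity) (mul_nonneg (by linarith) (by linarith))
    nlinarith
  refine isLargestNonUnitEigenvalue_of_firstSpan hq (sq_nonneg _)
    (pow_lt_one₀ hn hl two_ne_zero).ne
    (circuitC'_mulVec_mem_firstSpan hq) (circuitC'_mulVec_tripleVec_same hq) fun σ => ?_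
  rw [circuitC'_mulVec_reducedFirst hq]
  simp [kappa, hCdef, hQdef]

end Eigenvalue

/-! ### Uniqueness and the qubit limits. -/

theorem IsLargestNonUnitEigenvalue.unique {m : Type} [Fintype m] [DecidableEq m]
    {A : Matrix m m ℂ} {x y : ℝ} (hx : IsLargestNonUnitEigenvalue A x)
    (hy : IsLargestNonUnitEigenvalue A y) : x = y := by
  have h1 := hx.2 _ hy.1
  have h2 := hy.2 _ hx.1
  rw [Complex.norm_real] at h1 h2
  exact le_antisymm ((Real.le_norm_self x).trans h2) ((Real.le_norm_self y).trans h1)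

theorem tendsto_eigenvalue_qubit :
    Tendsto (fun N : ℕ => (((2 : ℝ) ^ (2 * N) - 2 ^ 4) / ((2 : ℝ) ^ (2 * N) - 2 ^ 2) *
      (1 / ((2 : ℝ) ^ 2 + 1))) ^ 2) atTop (nhds (1 / 25)) := by
  have hy : Tendsto (fun N : ℕ => ((1 : ℝ) / 4) ^ N) atTop (nhds 0) :=
    tendsto_pow_atTop_nhds_zero_of_lt_one (by norm_num) (by norm_num)
  -- Numerator and denominator are divided by `2 ^ (2 * N)`, giving a rational function of `(1 / 4)
  -- ^ N`.
  have h : Tendsto (fun N : ℕ => ((1 - 16 * ((1 : ℝ) / 4) ^ N) / (1 - 4 * ((1 : ℝ) / 4) ^ N) *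
      (1 / 5)) ^ 2) atTop (nhds (((1 - 16 * 0) / (1 - 4 * 0) * (1 / 5)) ^ 2)) :=
    ((((hy.const_mul 16).const_sub 1).div ((hy.const_mul 4).const_sub 1)
      (by norm_num)).mul_const _).pow 2
  norm_num only at h
  norm_num only
  refine h.congr fun N => ?_
  have h4 : ((1 : ℝ) / 4) ^ N = ((2 : ℝ) ^ (2 * N))⁻¹ := by
    rw [pow_mul, one_div, inv_pow]; norm_num
  rw [h4, ← mul_div_mul_left (1 - _) _ (by positivity : (2 : ℝ) ^ (2 * N) ≠ 0), mul_sub, mul_sub,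
    mul_left_comm, mul_left_comm _ (4 : ℝ), mul_inv_cancel₀ (by positivity)]
  norm_num

theorem tendsto_eigenvalue'_qubit :
    Tendsto (fun N : ℕ => (((2 : ℝ) ^ 2 - 1) / ((2 : ℝ) ^ N - (2 : ℝ) ^ (2 - (N : ℤ)))) ^ 2) atTop
      (nhds 0) := by
  have h1 : Tendsto (fun N : ℕ => (2 : ℝ) ^ N - 4) atTop atTop :=
    tendsto_atTop_add_const_right _ _ (tendsto_pow_atTop_atTop_of_one_lt (by norm_num))
  have h2 : Tendsto (fun N : ℕ => (2 : ℝ) ^ N - (2 : ℝ) ^ (2 - (N : ℤ))) atTop atTop := by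
    refine tendsto_atTop_mono (fun N => sub_le_sub_left ?_ _) h1
    calc (2 : ℝ) ^ (2 - (N : ℤ)) ≤ 2 ^ (2 : ℤ) := zpow_le_zpow_right₀ (by norm_num) (by omega)
      _ = 4 := by norm_num
  simpa using (h2.const_div_atTop ((2 : ℝ) ^ 2 - 1)).pow 2

end RandomCircuit

end

open RandomCircuit in
theorem lemma1 :
    (∀ N q : ℕ, 2 ≤ N → 2 ≤ q →
      IsLargestNonUnitEigenvalue (circuitC N q)
        ((((q : ℝ) ^ (2 * N) - (q : ℝ) ^ 4) / ((q : ℝ) ^ (2 * N) - (q : ℝ) ^ 2)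
          * (1 / ((q : ℝ) ^ 2 + 1))) ^ 2)) ∧
    (∀ N q : ℕ, 3 ≤ N → 2 ≤ q →
      IsLargestNonUnitEigenvalue (circuitC' N q)
        ((((q : ℝ) ^ 2 - 1) / ((q : ℝ) ^ N - (q : ℝ) ^ (2 - (N : ℤ)))) ^ 2)) ∧
    (∀ lam : ℕ → ℝ,
      (∀ N : ℕ, 3 ≤ N → IsLargestNonUnitEigenvalue (circuitC N 2) (lam N)) →
      Tendsto lam atTop (nhds (1 / 25))) ∧
    (∀ lam' : ℕ → ℝ,
      (∀ N : ℕ, 3 ≤ N → IsLargestNonUnitEigenvalue (circuitC' N 2) (lam' N)) →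
      Tendsto lam' atTop (nhds 0)) := by
  refine ⟨fun N q hN hq => isLargestNonUnitEigenvalue_circuitC hN hq,
    fun N q hN hq => isLargestNonUnitEigenvalue_circuitC' hN hq, fun lam h => ?_, fun lam' h => ?_⟩
  -- By uniqueness, any choice of largest non-unit eigenvalues agrees with the closed form from `N =
  -- 3` on.
  · refine tendsto_eigenvalue_qubit.congr' ?_
    filter_upwards [eventually_ge_atTop 3] with N hN
    simpa using (isLargestNonUnitEigenvalue_circuitC (by omega) le_rfl).unique (h N hN)
  · refine tendsto_eigenvalue'_qubit.congr' ?_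
    filter_upwards [eventually_ge_atTop 3] with N hN
    simpa using (isLargestNonUnitEigenvalue_circuitC' hN le_rfl).unique (h N hN)
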